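/- Let $m\ge 1$ and $n\ge 0$ be integers. For $1\le j\le m$ put $$\gamma_{m,j}:=(-1)^{j-1}\,\frac2j\binom{2m}{m+j}\Big/\binom{2m}{m}.$$ For a function $f\colon\mathbb R\to\mathbb R$ define the remainder of the alternative summation formula and the Euler--Maclaurin remainder for $\sum_{k=0}^{n-1}f(k)$ by $$R_m:=\frac1{(2m-1)!\,2^{2m+1}}\int_0^1 ds\,(1-s)^{2m-1}\int_{-1}^1 dv\,v^{2m}\sum_{j=1}^m\gamma_{m,j}\,j^{2m+1}\sum_{k=0}^{n-1}f^{(2m)}(k+jsv/2),$$ $$R^{\mathrm{EM}}_m:=\frac1{(2m-1)!}\int_0^{n-1}dx\,f^{(2m-1)}(x)\,B_{2m-1}(x-\lfloor x\rfloor),$$ where $B_j(\cdot)$ is the $j$th Bernoulli polynomial. For real $a>0$ and $\theta_0\in(0,\pi/2]$ let $$S:=\{-a+re^{i\theta}\colon r\ge0,\ |\theta|\le\theta_0\}\subset\mathbb C.$$ Suppose that $f\colon\mathbb R\to\mathbb R$ extends to a function, still denoted by $f$, from $\mathbb R\cup S$ to $\mathbb C$ that is continuous on $S$, holomorphic in the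 interior of $S$ (so that $f$ is smooth on the real interval $(-a,\infty)$), and satisfies, for some real $\mu\ge0$ and $\lambda\ge0$, $$|f(z)|\le\mu\,|z+a+1|^{\lambda}\qquad\text{for all } z\in S.$$ (i) If $a\ge(m+3)/2$ and $\lambda<2m-1$, then $$|R_m|\le\frac{C(\mu,\lambda,\theta_0,m)}{(a-m/2-1/2)^{2m-1-\lambda}},\qquad C(\mu,\lambda,\theta_0,m):=\frac{\mu\,(2+\sin\theta_0)^\lambda}{(2m+1)(2m-1-\lambda)(2\sin\theta_0)^{2m}}\sum_{j=1}^m|\gamma_{m,j}|\,j^{2m+1}.$$ (ii) If $m\ge4$, $n\ge1$, $\lambda<2m-2$, and either $a\ge1$ or $\lambda=0$ (in the latter case any $a>0$ is allowed), then $$|R^{\mathrm{EM}}_m|\le\frac{C^{\mathrm{EM}}(\mu,\lambda,\theta_0,m)}{a^{2m-2-\lambda}},\qquad C^{\mathrm{EM}}(\mu,\lambda,\theta_0,m):=\frac{2.02\,\mu\,(2+\sin\theta_0)^\lambda}{(2m-2-\lambda)(\sin\theta_0)^{2m-1}}\,\frac{(2m-1)!}{(2\pi)^{2m-1}}.$$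 -/

import Mathlib

noncomputable section

namespace AltSummation

/-- The coefficients `γ_{m,j} = (-1)^(j-1) (2/j) C(2m, m+j) / C(2m, m)`, for `1 ≤ j ≤ m`. -/
def gammaCoeff (m j : ℕ) : ℝ :=
  (-1) ^ (j - 1) * (2 / (j : ℝ)) * ((2 * m).choose (m + j) : ℝ) / ((2 * m).choose m : ℝ)

/-- The remainder `R_m` of the alternative summation formula for `f(0) + ⋯ + f(n-1)`, `m ≥ 1`. -/
def altRemainder (m n : ℕ) (f : ℝ → ℝ) : ℝ :=
  1 / (((2 * m - 1).factorial : ℝ) * 2 ^ (2 * m + 1)) *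
    ∫ s in (0 : ℝ)..1, (1 - s) ^ (2 * m - 1) *
      ∫ v in (-1 : ℝ)..1, v ^ (2 * m) *
        ∑ j ∈ Finset.Icc 1 m, gammaCoeff m j * (j : ℝ) ^ (2 * m + 1) *
          ∑ k ∈ Finset.range n, iteratedDeriv (2 * m) f ((k : ℝ) + (j : ℝ) * s * v / 2)

/-- The remainder `R^EM_m` of the Euler–Maclaurin formula for `f(0) + ⋯ + f(n-1)`, `m ≥ 1`;
`bernoulliFun` is the Bernoulli polynomial and `Int.fract x = x - ⌊x⌋`. -/
def emRemainder (m n : ℕ) (f : ℝ → ℝ) : ℝ :=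
  1 / ((2 * m - 1).factorial : ℝ) *
    ∫ x in (0 : ℝ)..((n : ℝ) - 1),
      iteratedDeriv (2 * m - 1) f x * bernoulliFun (2 * m - 1) (Int.fract x)

/-- The closed sector with vertex `-a` and half-angle `θ₀` around the positive direction. -/
def sector (a θ₀ : ℝ) : Set ℂ :=
  {z | ∃ r θ : ℝ, 0 ≤ r ∧ |θ| ≤ θ₀ ∧
    z = -(a : ℂ) + (r : ℂ) * Complex.exp (Complex.I * (θ : ℂ))}

/-- The constant `C(μ, λ, θ₀, m)`. -/
def altConst (μ lam θ₀ : ℝ) (m : ℕ) : ℝ :=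
  μ * (2 + Real.sin θ₀) ^ lam /
      ((2 * (m : ℝ) + 1) * (2 * (m : ℝ) - 1 - lam) * (2 * Real.sin θ₀) ^ (2 * m)) *
    ∑ j ∈ Finset.Icc 1 m, |gammaCoeff m j| * (j : ℝ) ^ (2 * m + 1)

/-- The constant `C^EM(μ, λ, θ₀, m)`. -/
def emConst (μ lam θ₀ : ℝ) (m : ℕ) : ℝ :=
  2.02 * μ * (2 + Real.sin θ₀) ^ lam /
      ((2 * (m : ℝ) - 2 - lam) * Real.sin θ₀ ^ (2 * m - 1)) *
    (((2 * m - 1).factorial : ℝ) / (2 * Real.pi) ^ (2 * m - 1))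

end AltSummation

end

/-!
For a real point `x > -a` of the sector, the closed disc of radius `(x + a) sin θ₀` about `x` lies
in the sector (`closedBall_subset_sector`). On it `‖z + a + 1‖ ≤ (2 + sin θ₀) (x + a)` once
`x + a ≥ 1`, so Cauchy's estimate on its boundary circle gives
`|f⁽ᴺ⁾(x)| ≤ N! μ (2 + sin θ₀)^λ (sin θ₀)^(-N) (x + a)^(λ - N)` (`abs_iteratedDeriv_le`); when
`λ = 0` the growth factor is constant and `x + a > 0` suffices. Both bounds follow by inserting
this estimate into the remainders.

In `altRemainder` the sum over `k` is controlled by the midpoint inequality for the convex function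
`t ↦ t^(-p)`: each term is at most the integral over the unit interval centred at it
(`rpow_neg_le_midpoint`), so the sum is at most an integral over a half-line (`sum_rpow_neg_le`).
This is what shifts `a - m/2`, the smallest possible distance from the vertex, by only `1/2`.

In `emRemainder` the derivative bound is integrated over `[0, n - 1]`, and the Bernoulli polynomial
is bounded through its Fourier series: `|B_N(x)| ≤ 2 N! (2π)^(-N) ∑ i^(-N)` on `[0, 1]`, where the
last sum is at most `1.01` for `N ≥ 7` (`abs_bernoulliFun_le`).

The integrands need not be shown measurable: a norm bound on an integral by the integral of an
integrable majorant holds in any case.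
-/

namespace AltSummation

/-! ### Sums of negative powers -/

/-- The graph of `t ↦ t ^ (-p)` on `(0, ∞)` lies above its tangent at `x`. -/
theorem rpow_tangent {x t p : ℝ} (hx : 0 < x) (ht : 0 < t) (hp : 0 ≤ p) :
    x ^ (-p) - p * x ^ (-p - 1) * (t - x) ≤ t ^ (-p) := by
  have hlog : Real.log (t / x) ≤ t / x - 1 := Real.log_le_sub_one_of_pos (by positivity)
  have h1 : 1 - p * (t / x - 1) ≤ (t / x) ^ (-p) := by
    rw [Real.rpow_def_of_pos (by positivity)]
    have := Real.add_one_le_exp (Real.log (t / x) * -p)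
    nlinarith
  have h2 : t ^ (-p) = x ^ (-p) * (t / x) ^ (-p) := by
    rw [← Real.mul_rpow hx.le (by positivity), mul_div_cancel₀ _ hx.ne']
  have h3 : x ^ (-p - 1) = x ^ (-p) / x := Real.rpow_sub_one hx.ne' _
  calc x ^ (-p) - p * x ^ (-p - 1) * (t - x) = x ^ (-p) * (1 - p * (t / x - 1)) := by
        rw [h3]; field_simp
    _ ≤ _ := by rw [h2]; gcongr

/-- The midpoint inequality `x ^ (-p) ≤ ∫ t ^ (-p)` over `[x - 1/2, x + 1/2]`, with the integral
evaluated. It follows by integrating the tangent bound, whose linear term cancels by symmetry. -/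
theorem rpow_neg_le_midpoint {x p : ℝ} (hx : 1 / 2 < x) (hp : 1 < p) :
    x ^ (-p) ≤ ((x - 1 / 2) ^ (1 - p) - (x + 1 / 2) ^ (1 - p)) / (p - 1) := by
  have hlt : x - 1 / 2 ≤ x + 1 / 2 := by linarith
  have hint : ∫ t in (x - 1 / 2)..(x + 1 / 2), t ^ (-p)
      = ((x - 1 / 2) ^ (1 - p) - (x + 1 / 2) ^ (1 - p)) / (p - 1) := by
    rw [integral_rpow]
    · rw [show -p + 1 = 1 - p by ring, ← neg_div_neg_eq]
      congr 1 <;> ring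
    · right
      refine ⟨by linarith, ?_⟩
      rw [Set.uIcc_of_le hlt]
      rintro ⟨h, -⟩
      linarith
  have htan : ∫ t in (x - 1 / 2)..(x + 1 / 2), (x ^ (-p) - p * x ^ (-p - 1) * (t - x))
      = x ^ (-p) := by
    rw [intervalIntegral.integral_sub (by simp) (by apply Continuous.intervalIntegrable; fun_prop),
      intervalIntegral.integral_const_mul, intervalIntegral.integral_sub (by simp) (by simp)]
    simp only [intervalIntegral.integral_const, integral_id, smul_eq_mul]
    ring
  rw [← hint, ← htan]
  refine intervalIntegral.integral_mono_on hlt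
    (by apply Continuous.intervalIntegrable; fun_prop) ?_ ?_
  · apply ContinuousOn.intervalIntegrable
    rw [Set.uIcc_of_le hlt]
    refine ContinuousOn.rpow_const continuousOn_id fun t ht => Or.inl (ne_of_gt ?_)
    exact lt_of_lt_of_le (by linarith) ht.1
  · intro t ht
    exact rpow_tangent (by linarith) (by linarith [ht.1]) (by linarith)

theorem sum_rpow_neg_le {b p : ℝ} (hb : 1 / 2 < b) (hp : 1 < p) (n : ℕ) :
    ∑ k ∈ Finset.range n, ((k : ℝ) + b) ^ (-p) ≤ (b - 1 / 2) ^ (1 - p) / (p - 1) := by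
  have hp' : 0 < p - 1 := by linarith
  calc ∑ k ∈ Finset.range n, ((k : ℝ) + b) ^ (-p)
      ≤ ∑ k ∈ Finset.range n, (((k : ℝ) + b - 1 / 2) ^ (1 - p) / (p - 1)
          - (((k + 1 : ℕ) : ℝ) + b - 1 / 2) ^ (1 - p) / (p - 1)) := by
        refine Finset.sum_le_sum fun k _ => ?_
        have hk : (0 : ℝ) ≤ k := Nat.cast_nonneg k
        refine (rpow_neg_le_midpoint (by linarith) hp).trans_eq ?_
        rw [← sub_div]
        push_cast
        ring_nf
    _ = ((b - 1 / 2) ^ (1 - p) - ((n : ℝ) + b - 1 / 2) ^ (1 - p)) / (p - 1) := by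
        rw [Finset.sum_range_sub' fun k : ℕ => ((k : ℝ) + b - 1 / 2) ^ (1 - p) / (p - 1)]
        simp [sub_div]
    _ ≤ _ := by
        gcongr
        have hn : (0 : ℝ) ≤ n := Nat.cast_nonneg n
        have : 0 ≤ ((n : ℝ) + b - 1 / 2) ^ (1 - p) := Real.rpow_nonneg (by linarith) _
        linarith

/-! ### Cauchy's estimate in the sector -/

theorem closedBall_subset_sector {a θ₀ x : ℝ} (hθ₀ : 0 < θ₀) (hx : 0 < x + a) :
    Metric.closedBall (x : ℂ) ((x + a) * Real.sin θ₀) ⊆ sector a θ₀ := by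
  intro z hz
  set w : ℂ := z + a with hw
  have hzw : ‖w - ((x + a : ℝ) : ℂ)‖ ≤ (x + a) * Real.sin θ₀ := by
    rw [mem_closedBall_iff_norm] at hz
    rwa [show w - ((x + a : ℝ) : ℂ) = z - x by rw [hw]; push_cast; ring]
  suffices h : ∃ θ : ℝ, |θ| ≤ θ₀ ∧ w = (‖w‖ : ℂ) * Complex.exp (Complex.I * (θ : ℂ)) by
    obtain ⟨θ, hθ, hwθ⟩ := h
    refine ⟨‖w‖, θ, norm_nonneg _, hθ, ?_⟩
    rw [← hwθ, hw]
    ring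
  generalize x + a = c at hx hzw
  rcases eq_or_ne w 0 with h0 | h0
  · exact ⟨0, by simpa using hθ₀.le, by simp [h0]⟩
  have hw0 : 0 < ‖w‖ := norm_pos_iff.2 h0
  have hsq : (w.re - c) ^ 2 + w.im ^ 2 ≤ c ^ 2 * Real.sin θ₀ ^ 2 := by
    have h := pow_le_pow_left₀ (norm_nonneg _) hzw 2
    rw [← Complex.normSq_eq_norm_sq, Complex.normSq_apply] at h
    simp only [Complex.sub_re, Complex.sub_im, Complex.ofReal_re, Complex.ofReal_im] at h
    nlinarith
  have hns : ‖w‖ ^ 2 = w.re ^ 2 + w.im ^ 2 := by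
    rw [← Complex.normSq_eq_norm_sq, Complex.normSq_apply]; ring
  have hcs := Real.sin_sq_add_cos_sq θ₀
  -- The ball condition is a quadratic inequality in `c`, so its discriminant is nonnegative.
  have hquad : c ^ 2 * Real.cos θ₀ ^ 2 - 2 * w.re * c + ‖w‖ ^ 2 ≤ 0 := by
    rw [hns]
    nlinarith
  have hre : 0 ≤ w.re := by
    by_contra! h
    nlinarith [mul_pos (neg_pos.2 h) hx, sq_nonneg (c * Real.cos θ₀), sq_nonneg ‖w‖]
  have hdisc : (‖w‖ * Real.cos θ₀) ^ 2 ≤ w.re ^ 2 := by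
    nlinarith [sq_nonneg (c * Real.cos θ₀ ^ 2 - w.re),
      mul_nonneg (sq_nonneg (Real.cos θ₀)) (sub_nonneg.2 hquad)]
  have hle : ‖w‖ * Real.cos θ₀ ≤ w.re := le_of_sq_le_sq hdisc hre
  refine ⟨w.arg, ?_, by rw [mul_comm Complex.I, Complex.norm_mul_exp_arg_mul_I]⟩
  by_contra! h
  have hlt : Real.cos w.arg < Real.cos θ₀ := by
    rw [← Real.cos_abs w.arg]
    exact Real.cos_lt_cos_of_nonneg_of_le_pi hθ₀.le (Complex.abs_arg_le_pi w) h
  rw [Complex.cos_arg h0, div_lt_iff₀ hw0] at hlt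
  linarith

theorem ball_subset_interior_sector {a θ₀ x : ℝ} (hθ₀ : 0 < θ₀) (hx : 0 < x + a) :
    Metric.ball (x : ℂ) ((x + a) * Real.sin θ₀) ⊆ interior (sector a θ₀) :=
  interior_maximal
    (Metric.ball_subset_closedBall.trans (closedBall_subset_sector hθ₀ hx)) Metric.isOpen_ball

/-- On a half-line where the complex-analytic `F` extends the real function `f`, the derivatives of
`f` are the real parts of those of `F`. -/
theorem iteratedDeriv_eq_re {a : ℝ} {U : Set ℂ} (hU : IsOpen U)
    (haU : ∀ x : ℝ, -a < x → (x : ℂ) ∈ U) {f : ℝ → ℝ} {F : ℂ → ℂ}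
    (hF : DifferentiableOn ℂ F U) (hFf : ∀ x : ℝ, -a < x → F x = f x) (N : ℕ) :
    ∀ x : ℝ, -a < x → iteratedDeriv N f x = (iteratedDeriv N F x).re := by
  induction N with
  | zero => intro x hx; simp [hFf x hx]
  | succ N ih =>
    intro x hx
    have han : AnalyticAt ℂ (iteratedDeriv N F) x := by
      rw [iteratedDeriv_eq_iterate]
      exact (hF.analyticAt (hU.mem_nhds (haU x hx))).iterated_deriv N
    have hd := han.differentiableAt.hasDerivAt.real_of_complex
    rw [iteratedDeriv_succ, iteratedDeriv_succ, ← hd.deriv]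
    apply Filter.EventuallyEq.deriv_eq
    filter_upwards [Ioi_mem_nhds hx] with y hy using ih y hy

/-- Cauchy's estimate on the circle about `x` of radius `(x + a) sin θ₀`. If `lam = 0` the factor
`‖z + a + 1‖ ^ lam` is `1`, so `1 ≤ x + a` is not needed. -/
theorem abs_iteratedDeriv_le {a θ₀ μ lam : ℝ} (hθ₀ : 0 < θ₀) (hθ₀' : θ₀ ≤ Real.pi / 2)
    (hμ : 0 ≤ μ) (hlam : 0 ≤ lam) {f : ℝ → ℝ} {F : ℂ → ℂ}
    (hFf : ∀ x : ℝ, (x : ℂ) ∈ sector a θ₀ → F (x : ℂ) = (f x : ℂ))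
    (hFcont : ContinuousOn F (sector a θ₀))
    (hFhol : DifferentiableOn ℂ F (interior (sector a θ₀)))
    (hFbound : ∀ z ∈ sector a θ₀, ‖F z‖ ≤ μ * ‖z + (a : ℂ) + 1‖ ^ lam)
    (N : ℕ) {x : ℝ} (hx : 0 < x + a) (hx1 : lam = 0 ∨ 1 ≤ x + a) :
    |iteratedDeriv N f x| ≤
      N.factorial * (μ * (2 + Real.sin θ₀) ^ lam / Real.sin θ₀ ^ N) * (x + a) ^ (lam - N) := by
  have hs : 0 < Real.sin θ₀ :=
    Real.sin_pos_of_pos_of_lt_pi hθ₀ (by linarith [Real.pi_pos])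
  have hmem : ∀ y : ℝ, -a < y → (y : ℂ) ∈ interior (sector a θ₀) := fun y hy =>
    ball_subset_interior_sector hθ₀ (by linarith)
      (Metric.mem_ball_self (mul_pos (by linarith) hs))
  rw [iteratedDeriv_eq_re isOpen_interior hmem hFhol
    (fun y hy => hFf y (interior_subset (hmem y hy))) N x (by linarith)]
  have hR : 0 < (x + a) * Real.sin θ₀ := mul_pos hx hs
  have hcl := closedBall_subset_sector hθ₀ hx
  have hdiff : DiffContOnCl ℂ F (Metric.ball (x : ℂ) ((x + a) * Real.sin θ₀)) :=
    ⟨hFhol.mono (ball_subset_interior_sector hθ₀ hx),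
      hFcont.mono (by rwa [closure_ball _ hR.ne'])⟩
  refine (Complex.abs_re_le_norm _).trans
    ((Complex.norm_iteratedDeriv_le_of_forall_mem_sphere_norm_le
      (C := μ * ((2 + Real.sin θ₀) * (x + a)) ^ lam) N hR hdiff fun z hz => ?_).trans_eq ?_)
  · refine (hFbound z (hcl (Metric.sphere_subset_closedBall hz))).trans ?_
    refine mul_le_mul_of_nonneg_left ?_ hμ
    rcases hx1 with rfl | hx1
    · simp
    refine Real.rpow_le_rpow (norm_nonneg _) ?_ hlam
    rw [mem_sphere_iff_norm] at hz
    calc ‖z + (a : ℂ) + 1‖ = ‖(z - x) + ((x + a + 1 : ℝ) : ℂ)‖ := by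
          congr 1; push_cast; ring
      _ ≤ ‖z - x‖ + ‖((x + a + 1 : ℝ) : ℂ)‖ := norm_add_le _ _
      _ = (x + a) * Real.sin θ₀ + (x + a + 1) := by
          rw [hz, Complex.norm_real, Real.norm_of_nonneg (by linarith)]
      _ ≤ _ := by linarith
  · rw [Real.mul_rpow (by positivity) hx.le, Real.rpow_sub hx, Real.rpow_natCast, mul_pow]
    field_simp

/-! ### Bernoulli polynomials on the unit interval -/

/-- `ζ(7) ≤ 1.01`, in terms of partial sums; the term at `n = 0` is `1 / 0 = 0`. -/
theorem sum_one_div_pow_seven_le (N : ℕ) :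
    ∑ n ∈ Finset.range N, 1 / (n : ℝ) ^ 7 ≤ 1.01 := by
  -- Two terms are kept exactly: the midpoint bound for the tail from `2` on exceeds `0.01`.
  have hmono : ∑ n ∈ Finset.range N, 1 / (n : ℝ) ^ 7 ≤
      ∑ n ∈ Finset.range (3 + N), 1 / (n : ℝ) ^ 7 :=
    Finset.sum_le_sum_of_subset_of_nonneg (Finset.range_mono (by omega))
      fun _ _ _ => by positivity
  refine hmono.trans ?_
  have htail := sum_rpow_neg_le (b := 3) (p := 7) (by norm_num) (by norm_num) N
  have hconv : ∀ k : ℕ, ((k : ℝ) + 3) ^ (-7 : ℝ) = 1 / ((3 + k : ℕ) : ℝ) ^ 7 := fun k => by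
    rw [Real.rpow_neg (by positivity), one_div, ← Real.rpow_natCast]
    push_cast
    rw [add_comm]
  have hend : ((3 : ℝ) - 1 / 2) ^ (1 - 7 : ℝ) / (7 - 1) ≤ 0.001 := by
    rw [show (1 - 7 : ℝ) = ((-6 : ℤ) : ℝ) by norm_num, Real.rpow_intCast]
    norm_num
  simp only [hconv] at htail
  rw [Finset.sum_range_add]
  have hhead : ∑ n ∈ Finset.range 3, 1 / (n : ℝ) ^ 7 = 1 + 1 / 128 := by
    norm_num [Finset.sum_range_succ]
  rw [hhead]
  norm_num at hend ⊢
  norm_num at htail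
  linarith

/-- The Fourier series of an odd Bernoulli polynomial of degree at least `7`, bounded term by
term. -/
theorem abs_bernoulliFun_le {k : ℕ} (hk : 3 ≤ k) {x : ℝ} (hx : x ∈ Set.Icc (0 : ℝ) 1) :
    |bernoulliFun (2 * k + 1) x| ≤
      2.02 * ((2 * k + 1).factorial / (2 * Real.pi) ^ (2 * k + 1)) := by
  have h := (hasSum_one_div_nat_pow_mul_sin (show k ≠ 0 by omega) hx).tendsto_sum_nat.abs
  have hle := le_of_tendsto' h fun N => (show _ ≤ (1.01 : ℝ) from by
    refine (Finset.abs_sum_le_sum_abs _ _).trans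
      ((Finset.sum_le_sum fun n _ => ?_).trans (sum_one_div_pow_seven_le N))
    rcases Nat.eq_zero_or_pos n with rfl | hn
    · simp
    have hn1 : (1 : ℝ) ≤ n := by exact_mod_cast hn
    rw [abs_mul, abs_of_nonneg (by positivity : 0 ≤ 1 / (n : ℝ) ^ (2 * k + 1))]
    calc 1 / (n : ℝ) ^ (2 * k + 1) * |Real.sin (2 * Real.pi * n * x)|
        ≤ 1 / (n : ℝ) ^ (2 * k + 1) * 1 := by gcongr; exact Real.abs_sin_le_one _
      _ ≤ 1 / (n : ℝ) ^ 7 := by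
        rw [mul_one]
        exact one_div_le_one_div_of_le (by positivity) (pow_le_pow_right₀ hn1 (by omega)))
  have hpi := Real.pi_pos
  change |_ * bernoulliFun (2 * k + 1) x| ≤ _ at hle
  rw [abs_mul, abs_div, abs_div, abs_mul, abs_pow, abs_neg, abs_one, one_pow, one_mul,
    abs_of_pos (by positivity : (0 : ℝ) < (2 * Real.pi) ^ (2 * k + 1)), abs_two, Nat.abs_cast,
    div_div, div_mul_eq_mul_div, div_le_iff₀ (by positivity)] at hle
  rw [← mul_div_assoc, le_div_iff₀ (by positivity)]
  linarith

/-! ### The two remainders -/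

/-- The bound on `altRemainder` for any `f` whose derivative of order `2m` decays like a power of
the distance to `-a`. -/
theorem abs_altRemainder_le {m : ℕ} (hm : 1 ≤ m) (n : ℕ) {a lam K : ℝ} {f : ℝ → ℝ}
    (ha : (m + 3) / 2 ≤ a) (hlam : lam < 2 * m - 1) (hK : 0 ≤ K)
    (hf : ∀ x : ℝ, 1 ≤ x + a →
      |iteratedDeriv (2 * m) f x| ≤ (2 * m).factorial * K * (x + a) ^ (lam - (2 * m : ℕ))) :
    |altRemainder m n f| ≤
      K / ((2 * m + 1) * (2 * m - 1 - lam) * 2 ^ (2 * m)) *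
        (∑ j ∈ Finset.Icc 1 m, |gammaCoeff m j| * (j : ℝ) ^ (2 * m + 1)) /
        (a - m / 2 - 1 / 2) ^ (2 * m - 1 - lam) := by
  have hm1 : (1 : ℝ) ≤ m := by exact_mod_cast hm
  set A : ℝ := a - m / 2 - 1 / 2 with hA
  have hA1 : 1 ≤ A := by linarith
  set p : ℝ := 2 * m - lam with hp
  have hp1 : 1 < p := by linarith
  set G : ℝ := ∑ j ∈ Finset.Icc 1 m, |gammaCoeff m j| * (j : ℝ) ^ (2 * m + 1) with hG
  set M : ℝ := (2 * m).factorial * K * (A ^ (1 - p) / (p - 1)) with hM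
  have hM0 : 0 ≤ M := by
    have : 0 < p - 1 := by linarith
    positivity
  have hsum : ∀ y : ℝ, -(m / 2) ≤ y →
      |∑ k ∈ Finset.range n, iteratedDeriv (2 * m) f (k + y)| ≤ M := by
    intro y hy
    calc |∑ k ∈ Finset.range n, iteratedDeriv (2 * m) f (k + y)|
        ≤ ∑ k ∈ Finset.range n, |iteratedDeriv (2 * m) f (k + y)| :=
          Finset.abs_sum_le_sum_abs _ _
      _ ≤ ∑ k ∈ Finset.range n, (2 * m).factorial * K * ((k : ℝ) + (y + a)) ^ (-p) := by
          refine Finset.sum_le_sum fun k _ => ?_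
          have hk : (0 : ℝ) ≤ k := Nat.cast_nonneg k
          have h := hf (k + y) (by linarith)
          rwa [add_assoc, show lam - (2 * m : ℕ) = -p by rw [hp]; push_cast; ring] at h
      _ ≤ (2 * m).factorial * K * ((y + a - 1 / 2) ^ (1 - p) / (p - 1)) := by
          rw [← Finset.mul_sum]
          gcongr
          exact sum_rpow_neg_le (by linarith) hp1 n
      _ ≤ M := by
          have : 0 < p - 1 := by linarith
          have := Real.rpow_le_rpow_of_nonpos (x := A) (y := y + a - 1 / 2) (z := 1 - p)
            (by linarith) (by linarith) (by linarith)
          rw [hM]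
          gcongr
  have hinner : ∀ s ∈ Set.Ioc (0 : ℝ) 1, ∀ v ∈ Set.Ioc (-1 : ℝ) 1,
      |∑ j ∈ Finset.Icc 1 m, gammaCoeff m j * (j : ℝ) ^ (2 * m + 1) *
        ∑ k ∈ Finset.range n, iteratedDeriv (2 * m) f (k + (j : ℝ) * s * v / 2)| ≤ G * M := by
    intro s hs v hv
    refine (Finset.abs_sum_le_sum_abs _ _).trans ?_
    rw [hG, Finset.sum_mul]
    refine Finset.sum_le_sum fun j hj => ?_
    rw [abs_mul, abs_mul, abs_of_nonneg (by positivity : (0 : ℝ) ≤ (j : ℝ) ^ (2 * m + 1))]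
    refine mul_le_mul_of_nonneg_left (hsum _ ?_) (by positivity)
    -- The evaluation points stay within `m / 2` of the integers `k`.
    have hjm : (j : ℝ) ≤ m := by exact_mod_cast (Finset.mem_Icc.1 hj).2
    have h1 : (j : ℝ) * s ≤ m :=
      (mul_le_of_le_one_right (Nat.cast_nonneg j) hs.2).trans hjm
    have h2 : 0 ≤ (j : ℝ) * s := mul_nonneg (Nat.cast_nonneg j) hs.1.le
    nlinarith [hv.1]
  have hv : ∀ s ∈ Set.Ioc (0 : ℝ) 1,
      |∫ v in (-1 : ℝ)..1, v ^ (2 * m) *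
        ∑ j ∈ Finset.Icc 1 m, gammaCoeff m j * (j : ℝ) ^ (2 * m + 1) *
          ∑ k ∈ Finset.range n, iteratedDeriv (2 * m) f (k + (j : ℝ) * s * v / 2)| ≤
        2 / (2 * m + 1) * (G * M) := by
    intro s hs
    have hval : ∫ v in (-1 : ℝ)..1, v ^ (2 * m) * (G * M) = 2 / (2 * m + 1) * (G * M) := by
      rw [intervalIntegral.integral_mul_const, integral_pow, one_pow,
        Odd.neg_one_pow ⟨m, rfl⟩]
      push_cast
      norm_num
    rw [← hval, ← Real.norm_eq_abs]
    refine intervalIntegral.norm_integral_le_of_norm_le (by norm_num)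
      (Filter.Eventually.of_forall fun v hv => ?_)
      (Continuous.intervalIntegrable (by fun_prop) _ _)
    have hv2 : 0 ≤ v ^ (2 * m) := (even_two_mul m).pow_nonneg v
    rw [norm_mul, Real.norm_of_nonneg hv2]
    exact mul_le_mul_of_nonneg_left (hinner s hs v hv) hv2
  have hout : |∫ s in (0 : ℝ)..1, (1 - s) ^ (2 * m - 1) *
      ∫ v in (-1 : ℝ)..1, v ^ (2 * m) *
        ∑ j ∈ Finset.Icc 1 m, gammaCoeff m j * (j : ℝ) ^ (2 * m + 1) *
          ∑ k ∈ Finset.range n, iteratedDeriv (2 * m) f (k + (j : ℝ) * s * v / 2)| ≤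
        1 / (2 * m) * (2 / (2 * m + 1) * (G * M)) := by
    have hval : ∫ s in (0 : ℝ)..1, (1 - s) ^ (2 * m - 1) * (2 / (2 * m + 1) * (G * M)) =
        1 / (2 * m) * (2 / (2 * m + 1) * (G * M)) := by
      rw [intervalIntegral.integral_mul_const,
        intervalIntegral.integral_comp_sub_left (fun s : ℝ => s ^ (2 * m - 1)), integral_pow,
        Nat.sub_add_cancel (by omega), Nat.cast_sub (by omega)]
      simp [show m ≠ 0 by omega]
    rw [← hval, ← Real.norm_eq_abs]
    refine intervalIntegral.norm_integral_le_of_norm_le (by norm_num)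
      (Filter.Eventually.of_forall fun s hs => ?_)
      (Continuous.intervalIntegrable (by fun_prop) _ _)
    have hs2 : 0 ≤ (1 - s) ^ (2 * m - 1) := pow_nonneg (by linarith [hs.2]) _
    rw [norm_mul, Real.norm_of_nonneg hs2]
    exact mul_le_mul_of_nonneg_left (hv s hs) hs2
  rw [altRemainder, abs_mul, abs_of_nonneg (by positivity)]
  refine (mul_le_mul_of_nonneg_left hout (by positivity)).trans_eq ?_
  have hfac : ((2 * m).factorial : ℝ) = 2 * m * (2 * m - 1).factorial := by
    rw [← Nat.mul_factorial_pred (show 2 * m ≠ 0 by omega)]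
    push_cast
    ring
  have hexp : A ^ (1 - p) = (A ^ (2 * (m : ℝ) - 1 - lam))⁻¹ := by
    rw [← Real.rpow_neg (by linarith)]
    congr 1
    ring
  have hAp : A ^ (2 * (m : ℝ) - 1 - lam) ≠ 0 := (Real.rpow_pos_of_pos (by linarith) _).ne'
  have hpe : p - 1 = 2 * m - 1 - lam := by ring
  have hp0 : 2 * (m : ℝ) - 1 - lam ≠ 0 := by linarith
  have hfac0 : ((2 * m - 1).factorial : ℝ) ≠ 0 := by positivity
  have hm0 : (m : ℝ) ≠ 0 := by linarith
  have hm2 : 2 * (m : ℝ) + 1 ≠ 0 := by linarith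
  rw [hM, hexp, hpe, hfac, pow_succ]
  field_simp

/-- The bound on `emRemainder` for any `f` whose derivative of order `2m - 1` decays like a power of
the distance to `-a`. -/
theorem abs_emRemainder_le {m n : ℕ} (hm : 4 ≤ m) (hn : 1 ≤ n) {a lam K : ℝ} {f : ℝ → ℝ}
    (ha : 0 < a) (hlam : lam < 2 * m - 2) (hK : 0 ≤ K)
    (hf : ∀ x : ℝ, 0 ≤ x → |iteratedDeriv (2 * m - 1) f x| ≤
      (2 * m - 1).factorial * K * (x + a) ^ (lam - (2 * m - 1 : ℕ))) :
    |emRemainder m n f| ≤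
      2.02 * K / (2 * m - 2 - lam) *
        ((2 * m - 1).factorial / (2 * Real.pi) ^ (2 * m - 1)) / a ^ (2 * m - 2 - lam) := by
  have hn1 : (0 : ℝ) ≤ n - 1 := by
    have : (1 : ℝ) ≤ n := by exact_mod_cast hn
    linarith
  set B : ℝ := 2.02 * ((2 * m - 1).factorial / (2 * Real.pi) ^ (2 * m - 1)) with hB
  have hpi := Real.pi_pos
  have hB0 : 0 ≤ B := by positivity
  set q : ℝ := 2 * m - 2 - lam with hq
  have hq0 : 0 < q := by linarith
  have hexp : lam - (2 * m - 1 : ℕ) = -q - 1 := by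
    rw [Nat.cast_sub (by omega), hq]
    push_cast
    ring
  have hber : ∀ x : ℝ, |bernoulliFun (2 * m - 1) (Int.fract x)| ≤ B := fun x => by
    have h := abs_bernoulliFun_le (k := m - 1) (by omega)
      ⟨Int.fract_nonneg x, (Int.fract_lt_one x).le⟩
    rwa [show 2 * (m - 1) + 1 = 2 * m - 1 by omega] at h
  have hpos : ∀ x ∈ Set.uIcc (0 : ℝ) (n - 1), 0 < x + a := fun x hx => by
    rw [Set.uIcc_of_le hn1] at hx
    linarith [hx.1]
  have hint : |∫ x in (0 : ℝ)..(n - 1),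
      iteratedDeriv (2 * m - 1) f x * bernoulliFun (2 * m - 1) (Int.fract x)| ≤
      ∫ x in (0 : ℝ)..(n - 1), (2 * m - 1).factorial * K * B * (x + a) ^ (-q - 1) := by
    rw [← Real.norm_eq_abs]
    refine intervalIntegral.norm_integral_le_of_norm_le hn1
      (Filter.Eventually.of_forall fun x hx => ?_) ?_
    · rw [norm_mul, Real.norm_eq_abs, Real.norm_eq_abs]
      have h := hf x hx.1.le
      rw [hexp] at h
      calc _ ≤ (2 * m - 1).factorial * K * (x + a) ^ (-q - 1) * B :=
            mul_le_mul h (hber x) (abs_nonneg _) ((abs_nonneg _).trans h)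
        _ = _ := by ring
    · apply ContinuousOn.intervalIntegrable
      have hlin : ContinuousOn (fun x : ℝ => x + a) (Set.uIcc 0 ((n : ℝ) - 1)) := by fun_prop
      exact continuousOn_const.mul (hlin.rpow_const fun x hx => Or.inl (hpos x hx).ne')
  have hval : ∫ x in (0 : ℝ)..(n - 1), (2 * m - 1).factorial * K * B * (x + a) ^ (-q - 1) ≤
      (2 * m - 1).factorial * K * B * (a ^ (-q) / q) := by
    rw [intervalIntegral.integral_const_mul,
      intervalIntegral.integral_comp_add_right (fun x : ℝ => x ^ (-q - 1)), zero_add,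
      integral_rpow]
    · refine mul_le_mul_of_nonneg_left ?_ (by positivity)
      rw [sub_add_cancel, ← neg_div_neg_eq, neg_neg, neg_sub]
      refine div_le_div_of_nonneg_right ?_ hq0.le
      have : 0 ≤ ((n : ℝ) - 1 + a) ^ (-q) := Real.rpow_nonneg (by linarith) _
      linarith
    · right
      refine ⟨by linarith, ?_⟩
      rw [Set.uIcc_of_le (by linarith)]
      rintro ⟨h, -⟩
      linarith
  rw [emRemainder, abs_mul, abs_of_nonneg (by positivity)]
  refine (mul_le_mul_of_nonneg_left (hint.trans hval) (by positivity)).trans_eq ?_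
  have hfac0 : ((2 * m - 1).factorial : ℝ) ≠ 0 := by positivity
  rw [hB, Real.rpow_neg ha.le]
  field_simp

end AltSummation

theorem proposition3 (m n : ℕ) (hm : 1 ≤ m)
    (a θ₀ μ lam : ℝ) (ha : 0 < a) (hθ₀ : 0 < θ₀) (hθ₀' : θ₀ ≤ Real.pi / 2)
    (hμ : 0 ≤ μ) (hlam : 0 ≤ lam)
    (f : ℝ → ℝ) (F : ℂ → ℂ)
    (hFf : ∀ x : ℝ, (x : ℂ) ∈ AltSummation.sector a θ₀ → F (x : ℂ) = (f x : ℂ))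
    (hFcont : ContinuousOn F (AltSummation.sector a θ₀))
    (hFhol : DifferentiableOn ℂ F (interior (AltSummation.sector a θ₀)))
    (hFbound : ∀ z ∈ AltSummation.sector a θ₀, ‖F z‖ ≤ μ * ‖z + (a : ℂ) + 1‖ ^ lam) :
    (((m : ℝ) + 3) / 2 ≤ a → lam < 2 * (m : ℝ) - 1 →
      |AltSummation.altRemainder m n f| ≤
        AltSummation.altConst μ lam θ₀ m /
          (a - (m : ℝ) / 2 - 1 / 2) ^ (2 * (m : ℝ) - 1 - lam)) ∧
    (4 ≤ m → 1 ≤ n → lam < 2 * (m : ℝ) - 2 → (lam = 0 ∨ 1 ≤ a) →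
      |AltSummation.emRemainder m n f| ≤
        AltSummation.emConst μ lam θ₀ m / a ^ (2 * (m : ℝ) - 2 - lam)) := by
  have hs : 0 < Real.sin θ₀ :=
    Real.sin_pos_of_pos_of_lt_pi hθ₀ (by linarith [Real.pi_pos])
  constructor
  · intro ham hl
    have hm1 : (1 : ℝ) ≤ m := by exact_mod_cast hm
    refine (AltSummation.abs_altRemainder_le hm n ham hl (by positivity) fun x hx =>
      AltSummation.abs_iteratedDeriv_le hθ₀ hθ₀' hμ hlam hFf hFcont hFhol hFbound (2 * m)
        (by linarith) (Or.inr hx)).trans_eq ?_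
    rw [AltSummation.altConst, mul_pow]
    congr 2
    rw [div_div]
    congr 1
    ring
  · intro hm4 hn hl hor
    refine (AltSummation.abs_emRemainder_le hm4 hn ha hl (by positivity) fun x hx =>
      AltSummation.abs_iteratedDeriv_le hθ₀ hθ₀' hμ hlam hFf hFcont hFhol hFbound (2 * m - 1)
        (by linarith) (hor.imp_right fun h => by linarith)).trans_eq ?_
    rw [AltSummation.emConst]
    congr 2
    rw [← mul_div_assoc, div_div, ← mul_assoc]
    congr 1
    ring
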